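/- Let $G$ be a finite nilpotent group. The enhanced power graph $\mathcal{G}_E(G)$ has vertex set $G$, and two distinct elements $x, y$ are adjacent if and only if there is $w \in G$ with $x, y \in \langle w\rangle$. The proper enhanced power graph $\mathcal{G}_E^{**}(G)$ is obtained from $\mathcal{G}_E(G)$ by deleting all dominating vertices, i.e. all vertices that are adjacent to every other vertex. A total (or strong) dominating set of a graph is a set $D$ of vertices such that every vertex of the graph, including those in $D$, has a neighbour in $D$; in particular, the empty set is a total dominating set of the graph without vertices. Then $\mathcal{G}_E^{**}(G)$ has no total dominating set if and only if the following two conditions hold: 1. $G$ is a non-cyclic $2$-group; 2. $G$ has an element of order $2$ that is contained in no proper cyclic subgroup of $G$ of order $2^k$ with $k \ge 2$. Moreover, if $G$ is a non-cyclic $2$-group, then every element as in (2) is an isolated vertex of $\mathcal{G}_E^{**}(G)$. -/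

import Mathlib

/-- The enhanced power graph of a group: the vertices are the group elements, and two distinct
elements are adjacent iff both lie in one cyclic subgroup `⟨w⟩`. -/
def enhancedPowerGraph (G : Type*) [Group G] : SimpleGraph G where
  Adj x y := x ≠ y ∧ ∃ w : G, x ∈ Subgroup.zpowers w ∧ y ∈ Subgroup.zpowers w
  symm := ⟨fun _ _ h => ⟨h.1.symm, h.2.imp fun _ hw => ⟨hw.2, hw.1⟩⟩⟩
  loopless := ⟨fun _ h => h.1 rfl⟩

/-- The vertices of the proper enhanced power graph: the elements that are not dominating
vertices of the enhanced power graph, a dominating vertex being one that is adjacent to every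
other vertex. -/
def properVertices (G : Type*) [Group G] : Set G :=
  (enhancedPowerGraph G).universalVertsᶜ

/-- The proper enhanced power graph: the enhanced power graph with all its dominating vertices
deleted. -/
def properEnhancedPowerGraph (G : Type*) [Group G] : SimpleGraph (properVertices G) :=
  (enhancedPowerGraph G).induce (properVertices G)

/-- A total (or strong) dominating set: every vertex of the graph, in `D` or not, has a neighbour
in `D`. -/
def IsTotalDominatingSet {V : Type*} (Γ : SimpleGraph V) (D : Set V) : Prop :=
  ∀ u : V, ∃ v ∈ D, Γ.Adj u v

/-- `a` has order `2` and lies in no proper cyclic subgroup of order `2 ^ k` with `k ≥ 2`. -/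
def IsCyclicallyIsolatedInvolution {G : Type*} [Group G] (a : G) : Prop :=
  orderOf a = 2 ∧
    ∀ H : Subgroup G, H ≠ ⊤ → IsCyclic H → ∀ k : ℕ, 2 ≤ k → Nat.card H = 2 ^ k → a ∉ H

/-! A graph has a total dominating set iff it has no isolated vertex. A non-dominating `a` is
isolated iff `a` is a power of no element but itself: any `w` with `a ∈ ⟨w⟩` is again
non-dominating, because everything adjacent to `w` is adjacent or equal to `a`. Such an `a`
satisfies `a ^ 2 = 1`, as it is a power of `a⁻¹`. If moreover `a` commutes with some `b` of odd
order, then `a` is a power of `a * b`, which forces `b = 1`. In a nilpotent group elements of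
coprime orders commute, since by induction on the nilpotency class their commutator is central,
hence of order dividing both; so a nilpotent torsion group with an isolated vertex is a
`2`-group. -/

section CoprimeOrders

open scoped commutatorElement

variable {G : Type*} [Group G]

theorem commutatorElement_pow_right_of_commute {a b : G} (h : Commute ⁅a, b⁆ b) (n : ℕ) :
    ⁅a, b ^ n⁆ = ⁅a, b⁆ ^ n := by
  have hconj : a * b * a⁻¹ = ⁅a, b⁆ * b := by group
  rw [commutatorElement_def, ← conj_pow, hconj, h.mul_pow, mul_inv_cancel_right]

theorem commute_of_commute_commutatorElement_of_coprime {m n : ℕ} (hmn : m.Coprime n) {a b : G}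
    (ha : a ^ m = 1) (hb : b ^ n = 1) (hca : Commute ⁅a, b⁆ a) (hcb : Commute ⁅a, b⁆ b) :
    Commute a b := by
  have hm : ⁅a, b⁆ ^ m = 1 := by
    have hca' : Commute ⁅b, a⁆ a := commutatorElement_inv a b ▸ hca.inv_left
    rw [← commutatorElement_inv b a, inv_pow, ← commutatorElement_pow_right_of_commute hca', ha,
      commutatorElement_one_right, inv_one]
  have hn : ⁅a, b⁆ ^ n = 1 := by
    rw [← commutatorElement_pow_right_of_commute hcb, hb, commutatorElement_one_right]
  exact commutatorElement_eq_one_iff_commute.1 ((pow_eq_one_iff_of_coprime hmn).1 ⟨hm, hn⟩)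

theorem commutatorElement_mem_center_of_commute_mk {a b : G}
    (h : Commute (a : G ⧸ Subgroup.center G) b) : ⁅a, b⁆ ∈ Subgroup.center G :=
  (QuotientGroup.eq_one_iff _).1 <|
    (map_commutatorElement (QuotientGroup.mk' _) a b).trans h.commutator_eq

theorem commute_of_pow_eq_one_of_coprime [Group.IsNilpotent G] {m n : ℕ} (hmn : m.Coprime n)
    {a b : G} (ha : a ^ m = 1) (hb : b ^ n = 1) : Commute a b := by
  suffices ∀ a b : G, a ^ m = 1 → b ^ n = 1 → Commute a b from this a b ha hb
  refine Group.nilpotent_center_quotient_ind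
    (P := fun G _ _ => ∀ a b : G, a ^ m = 1 → b ^ n = 1 → Commute a b) G
    (fun G _ _ a b _ _ => Subsingleton.elim _ _) (fun G _ _ ih a b ha hb => ?_)
  have hcentral : ⁅a, b⁆ ∈ Subgroup.center G :=
    commutatorElement_mem_center_of_commute_mk <|
      ih a b (by rw [← QuotientGroup.mk_pow, ha, QuotientGroup.mk_one])
        (by rw [← QuotientGroup.mk_pow, hb, QuotientGroup.mk_one])
  have hcommute (g : G) : Commute ⁅a, b⁆ g := (Subgroup.mem_center_iff.1 hcentral g).symm
  exact commute_of_commute_commutatorElement_of_coprime hmn ha hb (hcommute a) (hcommute b)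

end CoprimeOrders

theorem not_exists_isTotalDominatingSet_iff {V : Type*} {Γ : SimpleGraph V} :
    (¬ ∃ D : Set V, IsTotalDominatingSet Γ D) ↔ ∃ v, Γ.IsIsolated v := by
  constructor
  · intro hD
    by_contra! hv
    refine hD ⟨Set.univ, fun u => ?_⟩
    obtain ⟨v, huv⟩ := not_forall_not.1 (hv u)
    exact ⟨v, Set.mem_univ v, huv⟩
  · rintro ⟨v, hv⟩ ⟨D, hD⟩
    obtain ⟨u, -, hvu⟩ := hD v
    exact hv u hvu

section EnhancedPowerGraph

variable {G : Type*} [Group G] {a b w y : G}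

theorem mem_properVertices_iff :
    a ∈ properVertices G ↔
      ∃ y, ∀ w : G, a ∈ Subgroup.zpowers w → y ∉ Subgroup.zpowers w := by
  constructor
  · intro ha
    obtain ⟨y, hay, hadj⟩ : ∃ y, a ≠ y ∧ ¬ (enhancedPowerGraph G).Adj a y := by
      by_contra! hdom
      exact ha fun y hay => hdom y hay
    exact ⟨y, fun w haw hyw => hadj ⟨hay, w, haw, hyw⟩⟩
  · rintro ⟨y, hy⟩ hdom
    have hay : a ≠ y := by
      rintro rfl
      exact hy a (Subgroup.mem_zpowers a) (Subgroup.mem_zpowers a)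
    obtain ⟨-, w, haw, hyw⟩ := hdom hay
    exact hy w haw hyw

theorem mem_properVertices_of_mem_zpowers (ha : a ∈ properVertices G)
    (haw : a ∈ Subgroup.zpowers w) : w ∈ properVertices G := by
  obtain ⟨y, hy⟩ := mem_properVertices_iff.1 ha
  exact mem_properVertices_iff.2 ⟨y, fun v hwv => hy v (Subgroup.zpowers_le.2 hwv haw)⟩

theorem one_notMem_properVertices : (1 : G) ∉ properVertices G := by
  intro h
  obtain ⟨y, hy⟩ := mem_properVertices_iff.1 h
  exact hy y (one_mem _) (Subgroup.mem_zpowers y)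

theorem not_isCyclic_of_mem_properVertices (ha : a ∈ properVertices G) : ¬ IsCyclic G := by
  rintro ⟨g, hg⟩
  obtain ⟨y, hy⟩ := mem_properVertices_iff.1 ha
  exact hy g (hg a) (hg y)

theorem eq_one_or_eq_of_mem_zpowers (hw : w ^ 2 = 1) (hy : y ∈ Subgroup.zpowers w) :
    y = 1 ∨ y = w := by
  obtain ⟨n, rfl⟩ := Subgroup.mem_zpowers_iff.1 hy
  have hw' : w ^ (2 : ℤ) = 1 := mod_cast hw
  rcases Int.even_or_odd' n with ⟨k, rfl | rfl⟩
  · left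
    rw [zpow_mul, hw', one_zpow]
  · right
    rw [zpow_add_one, zpow_mul, hw', one_zpow, one_mul]

/-- `a` is a power of no group element other than itself, so that `⟨a⟩` is a maximal cyclic
subgroup with `a` as its only generator. For the vertices of the proper enhanced power graph this
is isolation, stated without reference to the graph. -/
def IsPowerOnlyOfSelf (a : G) : Prop :=
  ∀ w : G, a ∈ Subgroup.zpowers w → w = a

namespace IsPowerOnlyOfSelf

theorem sq_eq_one (h : IsPowerOnlyOfSelf a) : a ^ 2 = 1 := by
  have hinv : a⁻¹ = a := h a⁻¹ (by simp only [Subgroup.zpowers_inv, Subgroup.mem_zpowers])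
  rw [pow_two, mul_eq_one_iff_inv_eq, hinv]

theorem orderOf_eq_two [Nontrivial G] (h : IsPowerOnlyOfSelf a) : orderOf a = 2 := by
  refine orderOf_eq_prime h.sq_eq_one ?_
  rintro rfl
  obtain ⟨w, hw⟩ := exists_ne (1 : G)
  exact hw (h w (one_mem _))

theorem isCyclicallyIsolatedInvolution [Nontrivial G] (h : IsPowerOnlyOfSelf a) :
    IsCyclicallyIsolatedInvolution a := by
  refine ⟨h.orderOf_eq_two, fun H _ hH k hk hcard haH => ?_⟩
  obtain ⟨w, rfl⟩ := (Subgroup.isCyclic_iff_exists_zpowers_eq_top H).1 hH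
  have hpow : 2 ^ 1 = 2 ^ k := by
    rw [← hcard, Nat.card_zpowers, h w haH, h.orderOf_eq_two, pow_one]
  have hk1 : 1 = k := Nat.pow_right_injective le_rfl hpow
  omega

theorem eq_one_of_odd_of_commute (h : IsPowerOnlyOfSelf a) (hab : Commute a b) {m : ℕ}
    (hm : Odd m) (hb : b ^ m = 1) : b = 1 := by
  have ham : a ^ m = a := by
    obtain ⟨k, rfl⟩ := hm
    rw [pow_succ, pow_mul, h.sq_eq_one, one_pow, one_mul]
  have hpow : (a * b) ^ m = a := by rw [hab.mul_pow, ham, hb, mul_one]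
  exact mul_eq_left.1 (h (a * b) (Subgroup.mem_zpowers_iff.2 ⟨m, mod_cast hpow⟩))

theorem isPGroup_two [Group.IsNilpotent G] (hG : IsMulTorsion G) (h : IsPowerOnlyOfSelf a) :
    IsPGroup 2 G := by
  refine isPGroup_iff_pow_pow_eq_one.2 fun g => ?_
  obtain ⟨k, m, hm, horder⟩ := Nat.exists_eq_two_pow_mul_odd (hG g).orderOf_pos.ne'
  have hg : (g ^ 2 ^ k) ^ m = 1 := by rw [← pow_mul, ← horder, pow_orderOf_eq_one]
  have hcomm : Commute a (g ^ 2 ^ k) :=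
    commute_of_pow_eq_one_of_coprime (Nat.coprime_two_left.2 hm) h.sq_eq_one hg
  exact ⟨k, h.eq_one_of_odd_of_commute hcomm hm hg⟩

theorem mem_properVertices (h : IsPowerOnlyOfSelf a) (hG : ¬ IsCyclic G) :
    a ∈ properVertices G := by
  obtain ⟨y, hy⟩ : ∃ y, y ∉ Subgroup.zpowers a := by
    by_contra! hall
    exact hG ⟨a, hall⟩
  exact mem_properVertices_iff.2 ⟨y, fun w haw => (h w haw).symm ▸ hy⟩

end IsPowerOnlyOfSelf

theorem isIsolated_iff_isPowerOnlyOfSelf (ha : a ∈ properVertices G) :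
    (properEnhancedPowerGraph G).IsIsolated ⟨a, ha⟩ ↔ IsPowerOnlyOfSelf a := by
  constructor
  · intro h w haw
    by_contra hwa
    exact h ⟨w, mem_properVertices_of_mem_zpowers ha haw⟩
      ⟨Ne.symm hwa, w, haw, Subgroup.mem_zpowers w⟩
  · rintro h ⟨y, hy⟩ ⟨hay, w, haw, hyw⟩
    obtain rfl := h w haw
    rcases eq_one_or_eq_of_mem_zpowers h.sq_eq_one hyw with rfl | rfl
    · exact one_notMem_properVertices hy
    · exact hay rfl

theorem exists_isIsolated_iff :
    (∃ ha : a ∈ properVertices G, (properEnhancedPowerGraph G).IsIsolated ⟨a, ha⟩) ↔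
      ¬ IsCyclic G ∧ IsPowerOnlyOfSelf a := by
  constructor
  · rintro ⟨ha, h⟩
    exact ⟨not_isCyclic_of_mem_properVertices ha, (isIsolated_iff_isPowerOnlyOfSelf ha).1 h⟩
  · rintro ⟨hG, h⟩
    exact ⟨h.mem_properVertices hG, (isIsolated_iff_isPowerOnlyOfSelf _).2 h⟩

theorem IsCyclicallyIsolatedInvolution.isPowerOnlyOfSelf (ha : IsCyclicallyIsolatedInvolution a)
    (hG : IsPGroup 2 G) (hcyc : ¬ IsCyclic G) : IsPowerOnlyOfSelf a := by
  intro w haw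
  obtain ⟨k, hk⟩ := IsPGroup.iff_orderOf.1 hG w
  have hk_lt : k < 2 := by
    by_contra! hk_ge
    have hproper : Subgroup.zpowers w ≠ ⊤ := fun htop =>
      hcyc (isCyclic_iff_exists_zpowers_eq_top.2 ⟨w, htop⟩)
    exact ha.2 _ hproper inferInstance k hk_ge (by rw [Nat.card_zpowers, hk]) haw
  have hw : w ^ 2 = 1 :=
    orderOf_dvd_iff_pow_eq_one.1 (hk ▸ pow_dvd_pow 2 (Nat.le_of_lt_succ hk_lt))
  refine ((eq_one_or_eq_of_mem_zpowers hw haw).resolve_left ?_).symm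
  rintro rfl
  exact absurd (orderOf_one.symm.trans ha.1) (by decide)

end EnhancedPowerGraph

theorem mainTheorem1_general (G : Type*) [Group G] [Group.IsNilpotent G]
    (hG : IsMulTorsion G) :
    ((¬ ∃ D : Set (properVertices G), IsTotalDominatingSet (properEnhancedPowerGraph G) D) ↔
      (IsPGroup 2 G ∧ ¬ IsCyclic G) ∧ ∃ a : G, IsCyclicallyIsolatedInvolution a) ∧
    (IsPGroup 2 G → ¬ IsCyclic G → ∀ a : G, IsCyclicallyIsolatedInvolution a →
      ∃ ha : a ∈ properVertices G, (properEnhancedPowerGraph G).IsIsolated ⟨a, ha⟩) := by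
  have isolated_of_involution (hp : IsPGroup 2 G) (hcyc : ¬ IsCyclic G) (a : G)
      (ha : IsCyclicallyIsolatedInvolution a) :
      ∃ hmem : a ∈ properVertices G, (properEnhancedPowerGraph G).IsIsolated ⟨a, hmem⟩ :=
    exists_isIsolated_iff.2 ⟨hcyc, ha.isPowerOnlyOfSelf hp hcyc⟩
  refine ⟨?_, isolated_of_involution⟩
  rw [not_exists_isTotalDominatingSet_iff, Subtype.exists]
  constructor
  · rintro ⟨a, hisolated⟩
    obtain ⟨hcyc, ha⟩ := exists_isIsolated_iff.1 hisolated
    have : Nontrivial G := not_subsingleton_iff_nontrivial.1 fun _ => hcyc inferInstance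
    exact ⟨⟨ha.isPGroup_two hG, hcyc⟩, a, ha.isCyclicallyIsolatedInvolution⟩
  · rintro ⟨⟨hp, hcyc⟩, a, ha⟩
    exact ⟨a, isolated_of_involution hp hcyc a ha⟩

theorem mainTheorem1 (G : Type*) [Group G] [Finite G] [Group.IsNilpotent G] :
    ((¬ ∃ D : Set (properVertices G), IsTotalDominatingSet (properEnhancedPowerGraph G) D) ↔
      (IsPGroup 2 G ∧ ¬ IsCyclic G) ∧ ∃ a : G, IsCyclicallyIsolatedInvolution a) ∧
    (IsPGroup 2 G → ¬ IsCyclic G → ∀ a : G, IsCyclicallyIsolatedInvolution a →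
      ∃ ha : a ∈ properVertices G, (properEnhancedPowerGraph G).IsIsolated ⟨a, ha⟩) :=
  mainTheorem1_general G isMulTorsion_of_finite
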